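/- Let $G$ be a simple undirected graph on the vertex set $\{0,\dots,n-1\}$. For a vertex $v$ with neighbourhood $N_v$, the local complementation $G^v$ is obtained from $G$ by replacing the subgraph induced on $N_v$ by its complement. The LC orbit $[G]$ is the set of all graphs on $\{0,\dots,n-1\}$ that can be transformed into $G$ by a finite sequence of local complementations and vertex permutations. Let $\alpha(K)$ be the independence number of $K$, and put $\lambda(G)=\max_{K\in[G]}\alpha(K)$. A Boolean function $f:\mathbb{Z}_2^n\to\mathbb{Z}_2$ corresponds to a graph $K=(V,E)$ if $$f(\boldsymbol{x})=\sum_{\{i,j\}\in E}x_ix_j+\boldsymbol{b}\cdot\boldsymbol{x}+c \quad\text{for some } \boldsymbol{b}\in\mathbb{Z}_2^n,\ c\in\mathbb{Z}_2.$$ Let $\boldsymbol{s}=2^{-n/2}(-1)^{f(\boldsymbol{x})}$ be the associated vector of length $2^n$. Let $\mathcal{U}$ be the set of all matrices $$\begin{pmatrix}\cos\theta & \sin\theta\, e^{i\phi}\\ \sin\theta & -\cos\theta\, e^{i\phi}\end{pmatrix},\qquad \theta,\phi\in\mathbb{R},$$ let $\mathcal{U}^n$ be the set of all $U=U_0\otimes\cdots\otimes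 U_{n-1}$ with every $U_i\in\mathcal{U}$, and define $$\mathrm{PAR}_{\mathcal{U}}(\boldsymbol{s})=2^n\max_{U\in\mathcal{U}^n,\;k\in\mathbb{Z}_2^n}|(U\boldsymbol{s})_k|^2 .$$ If the LC orbit $[G]$ contains a bipartite graph, then for every function $f$ that corresponds to a graph in $[G]$ the maximum defining $\mathrm{PAR}_{\mathcal{U}}(\boldsymbol{s})$ is attained, and $\mathrm{PAR}_{\mathcal{U}}(\boldsymbol{s})=2^{\lambda(G)}$. -/

import Mathlib

namespace BipartiteLC

open scoped Matrix

/-- Local complementation at `v`: the subgraph induced on the neighbourhood of `v` is replaced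
by its complement, all other pairs are left unchanged. -/
def localComplement {n : ℕ} (G : SimpleGraph (Fin n)) (v : Fin n) : SimpleGraph (Fin n) where
  Adj a b := (G.Adj v a ∧ G.Adj v b ∧ a ≠ b ∧ ¬ G.Adj a b) ∨
    (¬ (G.Adj v a ∧ G.Adj v b) ∧ G.Adj a b)
  symm := ⟨fun a b h => by
    rcases h with ⟨h1, h2, h3, h4⟩ | ⟨h1, h2⟩
    · exact Or.inl ⟨h2, h1, h3.symm, fun h => h4 h.symm⟩
    · exact Or.inr ⟨fun h => h1 ⟨h.2, h.1⟩, h2.symm⟩⟩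
  loopless := ⟨fun a h => by
    rcases h with ⟨_, _, h, _⟩ | ⟨_, h⟩
    · exact h rfl
    · exact G.loopless.irrefl a h⟩

/-- `K'` arises from `K` by one local complementation or by one vertex permutation. -/
def LCStep {n : ℕ} (K K' : SimpleGraph (Fin n)) : Prop :=
  (∃ v : Fin n, K' = localComplement K v) ∨
    (∃ π : Equiv.Perm (Fin n), K' = K.map π.toEmbedding)

/-- The LC orbit `[G]`: all graphs on the same vertex set that can be transformed into `G` by a
finite sequence of local complementations and vertex permutations. -/
def lcOrbit {n : ℕ} (G : SimpleGraph (Fin n)) : Set (SimpleGraph (Fin n)) :=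
  {K | Relation.ReflTransGen LCStep K G}

/-- `λ(G)`, the maximum of the independence number over the LC orbit of `G`. -/
noncomputable def lam {n : ℕ} (G : SimpleGraph (Fin n)) : ℕ :=
  sSup (SimpleGraph.indepNum '' lcOrbit G)

/-- The supremum in `lam` is a maximum. -/
theorem isGreatest_lam {n : ℕ} (G : SimpleGraph (Fin n)) :
    IsGreatest (SimpleGraph.indepNum '' lcOrbit G) (lam G) := by
  have hne : (SimpleGraph.indepNum '' lcOrbit G).Nonempty :=
    ⟨_, G, Relation.ReflTransGen.refl, rfl⟩
  have hb : BddAbove (SimpleGraph.indepNum '' lcOrbit G) := (Set.toFinite _).bddAbove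
  exact ⟨Nat.sSup_mem hne hb, fun a ha => le_csSup hb ha⟩

open Classical in
/-- The Boolean function `f` corresponds to the graph `K`: its algebraic normal form has no terms
of degree above two, and the monomial `x_i x_j` (`i < j`) occurs in it exactly when `i j` is an
edge. Linear and constant terms are arbitrary. -/
def Corresponds {n : ℕ} (f : (Fin n → ZMod 2) → ZMod 2) (K : SimpleGraph (Fin n)) : Prop :=
  ∃ (b : Fin n → ZMod 2) (c : ZMod 2), ∀ x : Fin n → ZMod 2,
    f x = (∑ p : Fin n × Fin n with p.1 < p.2 ∧ K.Adj p.1 p.2, x p.1 * x p.2) +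
      (∑ i, b i * x i) + c

/-- The vector `s = 2^(-n/2) (-1)^f` of length `2^n`, indexed by the binary words of length `n`. -/
noncomputable def signVector {n : ℕ} (f : (Fin n → ZMod 2) → ZMod 2) : (Fin n → ZMod 2) → ℂ :=
  fun x => (((2 : ℝ) ^ (-(n : ℝ) / 2) : ℝ) : ℂ) * (-1) ^ (f x).val

/-- The tensor product `U_0 ⊗ ⋯ ⊗ U_{n-1}` of `2 × 2` matrices. -/
def tensor {n : ℕ} (U : Fin n → Matrix (ZMod 2) (ZMod 2) ℂ) :
    Matrix (Fin n → ZMod 2) (Fin n → ZMod 2) ℂ :=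
  Matrix.of fun k x => ∏ i, U i (k i) (x i)

/-- The values `2^n |S_k|^2`, where `S = U s`, over all `U ∈ T^n` and all indices `k`. -/
def powerSpectrum {n : ℕ} (T : Set (Matrix (ZMod 2) (ZMod 2) ℂ)) (s : (Fin n → ZMod 2) → ℂ) :
    Set ℝ :=
  {r | ∃ (U : Fin n → Matrix (ZMod 2) (ZMod 2) ℂ) (k : Fin n → ZMod 2),
    (∀ i, U i ∈ T) ∧ r = 2 ^ n * ‖(tensor U *ᵥ s) k‖ ^ 2}

/-- The peak-to-average power ratio of `s` with respect to `T^n`. -/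
noncomputable def PAR {n : ℕ} (T : Set (Matrix (ZMod 2) (ZMod 2) ℂ))
    (s : (Fin n → ZMod 2) → ℂ) : ℝ :=
  sSup (powerSpectrum T s)

/-- The matrix with rows `(cos θ, sin θ e^{iφ})` and `(sin θ, -cos θ e^{iφ})`. -/
noncomputable def uMatrix (θ φ : ℝ) : Matrix (ZMod 2) (ZMod 2) ℂ :=
  Matrix.of fun r c =>
    if r = 0 then
      if c = 0 then (Real.cos θ : ℂ) else (Real.sin θ : ℂ) * Complex.exp (Complex.I * φ)
    else
      if c = 0 then (Real.sin θ : ℂ) else -(Real.cos θ : ℂ) * Complex.exp (Complex.I * φ)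

/-- The infinite transform set `𝓤`: all matrices `uMatrix θ φ` with `θ`, `φ` real. -/
def transformU : Set (Matrix (ZMod 2) (ZMod 2) ℂ) :=
  {M | ∃ θ φ : ℝ, M = uMatrix θ φ}

end BipartiteLC

namespace BipartiteLC

open scoped Matrix

/-! Up to phase, the rows of matrices in `transformU` are exactly the unit vectors of ℂ². So the
power spectrum is the set of values 2^n |⟨v, s⟩|² over products v of unit vectors, which local
unitaries cannot change. Affine terms of f and local complementations act by local unitaries and a
global phase, and vertex permutations only relabel factors. Hence the spectrum is constant on the
orbit, and two bounds suffice.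

Lower bound: if T is independent, the quadratic form vanishes on words supported in T. The product
that is uniform on T and is the basis vector at 0 elsewhere gives 2^|T|
(`two_pow_indepNum_mem_productSpectrum`).

Upper bound: let B be bipartite with side X. Hadamards outside X turn its state into a multiple of
the indicator of a binary code C of dimension |X|. Let d(A) be the dimension of the subcode
vanishing on A. Cauchy–Schwarz across S and Sᶜ bounds every spectral value by 2^(|Xᶜ| + d(S) +
d(Sᶜ)). A min-max argument of matroid-union type (`exists_le_rank_add_rank_sdiff`) supplies S and I
with d(S) + d(Sᶜ) ≤ 2 d(I) − |Iᶜ|. Pivoting moves X, inside the orbit and without changing C, to an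
information set X' for which X' ∩ I spans I. In that graph the symmetric difference of X' and I is
independent, and since d(I) ≤ |X' \ I| its size is at least the exponent. -/

/-! ### Product vectors and the transform set -/

/-- The overlap of `s` with the product vector `v_0 ⊗ ⋯ ⊗ v_{n-1}` (no conjugation). -/
noncomputable def overlap {n : ℕ} (v : Fin n → ZMod 2 → ℂ) (s : (Fin n → ZMod 2) → ℂ) : ℂ :=
  ∑ x, (∏ i, v i (x i)) * s x

/-- Unit vectors of `ℂ²`. -/
def IsUnitVec (w : ZMod 2 → ℂ) : Prop := ‖w 0‖ ^ 2 + ‖w 1‖ ^ 2 = 1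

/-- The values `2^n |⟨v, s⟩|^2` over all products `v` of unit vectors. -/
def productSpectrum {n : ℕ} (s : (Fin n → ZMod 2) → ℂ) : Set ℝ :=
  {r | ∃ v : Fin n → ZMod 2 → ℂ, (∀ i, IsUnitVec (v i)) ∧ r = 2 ^ n * ‖overlap v s‖ ^ 2}

theorem sum_zmod_two {M : Type*} [AddCommMonoid M] (g : ZMod 2 → M) : ∑ a, g a = g 0 + g 1 :=
  Fin.sum_univ_two g

theorem zmod_two_eq (a : ZMod 2) : a = 0 ∨ a = 1 := by
  revert a; decide

theorem isUnitVec_uMatrix_row (θ φ : ℝ) (k : ZMod 2) : IsUnitVec (uMatrix θ φ k) := by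
  have h : ‖Complex.exp (Complex.I * φ)‖ = 1 := by
    rw [mul_comm]; exact Complex.norm_exp_ofReal_mul_I φ
  rcases zmod_two_eq k with rfl | rfl
  · simp only [IsUnitVec, uMatrix, Matrix.of_apply, if_true, one_ne_zero, if_false, norm_mul, h,
      Complex.norm_real, Real.norm_eq_abs, mul_one, sq_abs]
    exact Real.cos_sq_add_sin_sq θ
  · simp only [IsUnitVec, uMatrix, Matrix.of_apply, if_true, one_ne_zero, if_false, norm_mul, h,
      Complex.norm_real, Real.norm_eq_abs, mul_one, sq_abs, norm_neg]
    exact Real.sin_sq_add_cos_sq θ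

/-- A unit vector has moduli cos θ and sin θ for some θ. Removing the phase of its first entry
leaves one relative phase φ. -/
theorem IsUnitVec.exists_uMatrix {w : ZMod 2 → ℂ} (hw : IsUnitVec w) :
    ∃ (θ φ : ℝ) (ζ : ℂ), ‖ζ‖ = 1 ∧ ∀ a, uMatrix θ φ 0 a = ζ * w a := by
  have hz : (↑‖w 0‖ + ↑‖w 1‖ * Complex.I : ℂ) ≠ 0 := by
    intro h
    have h0 := congrArg Complex.re h
    have h1 := congrArg Complex.im h
    simp at h0 h1
    simp [IsUnitVec, h0, h1] at hw
  have hn : ‖(↑‖w 0‖ + ↑‖w 1‖ * Complex.I : ℂ)‖ = 1 := by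
    rw [Complex.norm_add_mul_I, hw, Real.sqrt_one]
  set θ := Complex.arg (↑‖w 0‖ + ↑‖w 1‖ * Complex.I : ℂ) with hθ
  have hc : Real.cos θ = ‖w 0‖ := by
    rw [hθ, Complex.cos_arg hz, hn]; simp
  have hs : Real.sin θ = ‖w 1‖ := by
    rw [hθ, Complex.sin_arg, hn]; simp
  refine ⟨θ, (w 1).arg - (w 0).arg, Complex.exp (-((w 0).arg * Complex.I)), ?_, ?_⟩
  · rw [← neg_mul, ← Complex.ofReal_neg]; exact Complex.norm_exp_ofReal_mul_I _
  · intro a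
    rcases zmod_two_eq a with rfl | rfl
    · simp only [uMatrix, Matrix.of_apply, if_true, hc]
      conv_rhs => rw [← Complex.norm_mul_exp_arg_mul_I (w 0)]
      rw [mul_left_comm, ← Complex.exp_add]
      simp
    · simp only [uMatrix, Matrix.of_apply, if_true, one_ne_zero, if_false, hs]
      conv_rhs => rw [← Complex.norm_mul_exp_arg_mul_I (w 1)]
      rw [mul_left_comm, ← Complex.exp_add]
      push_cast
      ring_nf

theorem overlap_mul {n : ℕ} (ζ : Fin n → ℂ) (v : Fin n → ZMod 2 → ℂ)
    (s : (Fin n → ZMod 2) → ℂ) :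
    overlap (fun i a => ζ i * v i a) s = (∏ i, ζ i) * overlap v s := by
  simp only [overlap, Finset.prod_mul_distrib, Finset.mul_sum, mul_assoc]

theorem powerSpectrum_transformU {n : ℕ} (s : (Fin n → ZMod 2) → ℂ) :
    powerSpectrum transformU s = productSpectrum s := by
  ext r
  constructor
  · rintro ⟨U, k, hU, rfl⟩
    refine ⟨fun i => U i (k i), fun i => ?_, ?_⟩
    · obtain ⟨θ, φ, h⟩ := hU i
      have := isUnitVec_uMatrix_row θ φ (k i)
      rwa [← h] at this
    · simp [overlap, tensor, Matrix.mulVec, dotProduct]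
  · rintro ⟨v, hv, rfl⟩
    choose θ φ ζ hζ h using fun i => (hv i).exists_uMatrix
    -- Row 0 already realises every unit vector up to phase, so the index k = 0 suffices.
    refine ⟨fun i => uMatrix (θ i) (φ i), 0, fun i => ⟨_, _, rfl⟩, ?_⟩
    have : (tensor (fun i => uMatrix (θ i) (φ i)) *ᵥ s) 0 =
        overlap (fun i a => ζ i * v i a) s := by
      simp [overlap, tensor, Matrix.mulVec, dotProduct, h]
    rw [this, overlap_mul, norm_mul, norm_prod]
    simp [hζ]

/-! ### Local isometries -/

/-- A `2 × 2` matrix acting on rows as an isometry. -/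
def PreservesUnit (W : Matrix (ZMod 2) (ZMod 2) ℂ) : Prop :=
  ∀ w, IsUnitVec w → IsUnitVec (w ᵥ* W)

theorem overlap_tensor_mulVec {n : ℕ} (W : Fin n → Matrix (ZMod 2) (ZMod 2) ℂ)
    (v : Fin n → ZMod 2 → ℂ) (s : (Fin n → ZMod 2) → ℂ) :
    overlap v (tensor W *ᵥ s) = overlap (fun i => v i ᵥ* W i) s := by
  simp only [overlap, tensor, Matrix.mulVec, Matrix.vecMul, dotProduct, Matrix.of_apply,
    Finset.mul_sum]
  rw [Finset.sum_comm]
  refine Finset.sum_congr rfl fun y _ => ?_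
  rw [Finset.prod_univ_sum, Fintype.piFinset_univ, Finset.sum_mul]
  refine Finset.sum_congr rfl fun x _ => ?_
  rw [Finset.prod_mul_distrib, mul_assoc]

/-- A tensor product of matrices can be moved from s onto the factors of v, which remain unit
vectors. -/
theorem productSpectrum_smul_tensor_subset {n : ℕ} {W : Fin n → Matrix (ZMod 2) (ZMod 2) ℂ}
    (hW : ∀ i, PreservesUnit (W i)) {ζ : ℂ} (hζ : ‖ζ‖ = 1) (s : (Fin n → ZMod 2) → ℂ) :
    productSpectrum (ζ • (tensor W *ᵥ s)) ⊆ productSpectrum s := by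
  rintro r ⟨v, hv, rfl⟩
  refine ⟨fun i => v i ᵥ* W i, fun i => hW i _ (hv i), ?_⟩
  rw [← overlap_tensor_mulVec]
  have : overlap v (ζ • (tensor W *ᵥ s)) = ζ * overlap v (tensor W *ᵥ s) := by
    simp only [overlap, Pi.smul_apply, smul_eq_mul, Finset.mul_sum]
    exact Finset.sum_congr rfl fun x _ => by ring
  rw [this, norm_mul, hζ, one_mul]

theorem preservesUnit_of_diagonal {W : Matrix (ZMod 2) (ZMod 2) ℂ} (h01 : W 0 1 = 0)
    (h10 : W 1 0 = 0) (h0 : ‖W 0 0‖ = 1) (h1 : ‖W 1 1‖ = 1) : PreservesUnit W := by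
  intro w hw
  simpa [IsUnitVec, Matrix.vecMul, dotProduct, sum_zmod_two, h01, h10, h0, h1] using hw

theorem norm_sq_add_sub (a b : ℂ) : ‖a + b‖ ^ 2 + ‖a - b‖ ^ 2 = 2 * (‖a‖ ^ 2 + ‖b‖ ^ 2) := by
  have := parallelogram_law_with_norm ℝ a b
  simpa only [sq] using this

theorem norm_inv_sqrt_two_sq : ‖((Real.sqrt 2 : ℝ) : ℂ)⁻¹‖ ^ 2 = 1 / 2 := by
  rw [norm_inv, Complex.norm_real, Real.norm_of_nonneg (Real.sqrt_nonneg 2), inv_pow,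
    Real.sq_sqrt zero_le_two, one_div]

/-- The Hadamard matrix. -/
noncomputable def hadamard : Matrix (ZMod 2) (ZMod 2) ℂ :=
  Matrix.of fun r c => ((Real.sqrt 2 : ℝ) : ℂ)⁻¹ * (-1) ^ (r * c).val

theorem preservesUnit_hadamard : PreservesUnit hadamard := by
  intro w hw
  have e0 : (w ᵥ* hadamard) 0 = ((Real.sqrt 2 : ℝ) : ℂ)⁻¹ * (w 0 + w 1) := by
    simp [hadamard, Matrix.vecMul, dotProduct, sum_zmod_two]; ring
  have e1 : (w ᵥ* hadamard) 1 = ((Real.sqrt 2 : ℝ) : ℂ)⁻¹ * (w 0 - w 1) := by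
    simp [hadamard, Matrix.vecMul, dotProduct, sum_zmod_two, ZMod.val_one]; ring
  rw [IsUnitVec, e0, e1, norm_mul, norm_mul, mul_pow, mul_pow, ← mul_add, norm_sq_add_sub,
    norm_inv_sqrt_two_sq, hw]
  norm_num

/-- The matrix `(1 + i X) / √2`, where `X` is the bit flip. -/
noncomputable def flipRoot : Matrix (ZMod 2) (ZMod 2) ℂ :=
  Matrix.of fun r c => ((Real.sqrt 2 : ℝ) : ℂ)⁻¹ * Complex.I ^ (r + c).val

theorem preservesUnit_flipRoot : PreservesUnit flipRoot := by
  intro w hw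
  have h2 : (1 + 1 : ZMod 2) = 0 := rfl
  have e0 : (w ᵥ* flipRoot) 0 = ((Real.sqrt 2 : ℝ) : ℂ)⁻¹ * (w 0 + Complex.I * w 1) := by
    simp [flipRoot, Matrix.vecMul, dotProduct, sum_zmod_two, ZMod.val_one]; ring
  have e1 : (w ᵥ* flipRoot) 1 =
      ((Real.sqrt 2 : ℝ) : ℂ)⁻¹ * (Complex.I * (w 0 - Complex.I * w 1)) := by
    simp [flipRoot, Matrix.vecMul, dotProduct, sum_zmod_two, ZMod.val_one, h2, mul_sub,
      ← mul_assoc]; ring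
  rw [IsUnitVec, e0, e1, norm_mul, norm_mul, norm_mul Complex.I, Complex.norm_I, one_mul, mul_pow,
    mul_pow, ← mul_add, norm_sq_add_sub, norm_inv_sqrt_two_sq, norm_mul, Complex.norm_I, one_mul,
    hw]
  norm_num

/-! ### Signs, adjacency and quadratic forms over `ZMod 2` -/

/-- The sign `(-1)^a`. -/
def sgn (a : ZMod 2) : ℂ := (-1) ^ a.val

theorem sgn_zero : sgn 0 = 1 := by simp [sgn]

theorem sgn_one : sgn 1 = -1 := by simp [sgn, ZMod.val_one]

theorem sgn_add (a b : ZMod 2) : sgn (a + b) = sgn a * sgn b := by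
  have h2 : (1 + 1 : ZMod 2) = 0 := rfl
  rcases zmod_two_eq a with rfl | rfl <;> rcases zmod_two_eq b with rfl | rfl <;>
    simp [sgn_zero, sgn_one, h2]

theorem sgn_mul_self (a : ZMod 2) : sgn a * sgn a = 1 := by
  rcases zmod_two_eq a with rfl | rfl <;> simp [sgn_zero, sgn_one]

theorem norm_sgn (a : ZMod 2) : ‖sgn a‖ = 1 := by
  simp [sgn]

theorem sgn_sum {ι : Type*} (s : Finset ι) (g : ι → ZMod 2) :
    sgn (∑ i ∈ s, g i) = ∏ i ∈ s, sgn (g i) := by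
  classical
  induction s using Finset.induction_on with
  | empty => simp [sgn_zero]
  | insert a s ha ih => rw [Finset.sum_insert ha, Finset.prod_insert ha, sgn_add, ih]

open Classical in
/-- The adjacency matrix over `ZMod 2`. -/
noncomputable def adjEntry {n : ℕ} (K : SimpleGraph (Fin n)) (i j : Fin n) : ZMod 2 :=
  if K.Adj i j then 1 else 0

theorem adjEntry_comm {n : ℕ} (K : SimpleGraph (Fin n)) (i j : Fin n) :
    adjEntry K i j = adjEntry K j i := by
  classical unfold adjEntry; exact if_congr (K.adj_comm i j) rfl rfl

theorem adjEntry_self {n : ℕ} (K : SimpleGraph (Fin n)) (i : Fin n) : adjEntry K i i = 0 := by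
  simp [adjEntry]

theorem adjEntry_eq_one {n : ℕ} {K : SimpleGraph (Fin n)} {i j : Fin n} :
    adjEntry K i j = 1 ↔ K.Adj i j := by
  simp [adjEntry]

theorem adjEntry_eq_zero {n : ℕ} {K : SimpleGraph (Fin n)} {i j : Fin n} :
    adjEntry K i j = 0 ↔ ¬ K.Adj i j := by
  simp [adjEntry]

theorem adjEntry_injective {n : ℕ} {K K' : SimpleGraph (Fin n)}
    (h : ∀ i j, adjEntry K i j = adjEntry K' i j) : K = K' := by
  ext i j
  rw [← adjEntry_eq_one, h, adjEntry_eq_one]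

theorem adjEntry_localComplement {n : ℕ} (K : SimpleGraph (Fin n)) (v i j : Fin n) :
    adjEntry (localComplement K v) i j =
      if i = j then 0 else adjEntry K i j + adjEntry K v i * adjEntry K v j := by
  by_cases hij : i = j
  · simp [hij, adjEntry_self]
  · by_cases h1 : K.Adj v i <;> by_cases h2 : K.Adj v j <;> by_cases h3 : K.Adj i j <;>
      simp [adjEntry, localComplement, hij, h1, h2, h3]; rfl

theorem adjEntry_localComplement_left {n : ℕ} (K : SimpleGraph (Fin n)) (v j : Fin n) :
    adjEntry (localComplement K v) v j = adjEntry K v j := by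
  rw [adjEntry_localComplement, adjEntry_self]
  by_cases h : v = j <;> simp [h, adjEntry_self]

theorem localComplement_localComplement {n : ℕ} (K : SimpleGraph (Fin n)) (v : Fin n) :
    localComplement (localComplement K v) v = K := by
  refine adjEntry_injective fun i j => ?_
  have h2 : ∀ a b : ZMod 2, a + b + b = a := by decide
  rw [adjEntry_localComplement, adjEntry_localComplement_left, adjEntry_localComplement_left,
    adjEntry_localComplement]
  by_cases h : i = j <;> simp [h, adjEntry_self, h2]

theorem map_map_symm {n : ℕ} (K : SimpleGraph (Fin n)) (π : Equiv.Perm (Fin n)) :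
    (K.map π.toEmbedding).map π.symm.toEmbedding = K := by
  rw [SimpleGraph.map_map]
  convert SimpleGraph.map_id K
  ext; simp

theorem adjEntry_map {n : ℕ} (K : SimpleGraph (Fin n)) (π : Equiv.Perm (Fin n)) (i j : Fin n) :
    adjEntry (K.map π.toEmbedding) (π i) (π j) = adjEntry K i j := by
  have := SimpleGraph.map_adj_apply (G := K) (f := π.toEmbedding) (a := i) (b := j)
  by_cases h : K.Adj i j
  · rw [adjEntry_eq_one.mpr h]
    exact adjEntry_eq_one.mpr (this.mpr h)
  · rw [adjEntry_eq_zero.mpr h]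
    exact adjEntry_eq_zero.mpr (h ∘ this.mp)

/-- The sum of a function over ordered pairs `i < j`. -/
def sumLt {n : ℕ} {M : Type*} [AddCommMonoid M] (F : Fin n → Fin n → M) : M :=
  ∑ i, ∑ j, if i < j then F i j else 0

theorem sumLt_add {n : ℕ} {M : Type*} [AddCommMonoid M] (F F' : Fin n → Fin n → M) :
    sumLt (fun i j => F i j + F' i j) = sumLt F + sumLt F' := by
  simp only [sumLt, ← Finset.sum_add_distrib]
  exact Finset.sum_congr rfl fun i _ => Finset.sum_congr rfl fun j _ => by split_ifs <;> simp

theorem sumLt_add_swap {n : ℕ} {M : Type*} [AddCommMonoid M] (F : Fin n → Fin n → M)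
    (hF : ∀ i, F i i = 0) : sumLt (fun i j => F i j + F j i) = ∑ i, ∑ j, F i j := by
  rw [sumLt_add]
  have : sumLt (fun i j => F j i) = ∑ i, ∑ j, if j < i then F i j else 0 := by
    rw [sumLt, Finset.sum_comm]
  rw [this]
  simp only [sumLt, ← Finset.sum_add_distrib]
  refine Finset.sum_congr rfl fun i _ => Finset.sum_congr rfl fun j _ => ?_
  rcases lt_trichotomy i j with h | h | h
  · simp [h, h.not_gt]
  · simp [h, hF]
  · simp [h, h.not_gt]

theorem sumLt_eq_sum_filter {n : ℕ} {M : Type*} [AddCommMonoid M] (F : Fin n → Fin n → M) :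
    sumLt F = ∑ p : Fin n × Fin n with p.1 < p.2, F p.1 p.2 := by
  rw [Finset.sum_filter, Fintype.sum_prod_type]; rfl

theorem sumLt_perm {n : ℕ} {M : Type*} [AddCommMonoid M] (F : Fin n → Fin n → M)
    (hF : ∀ i j, F i j = F j i) (π : Equiv.Perm (Fin n)) :
    sumLt (fun i j => F (π i) (π j)) = sumLt F := by
  -- The order i < j is not preserved by π, so both sums are rewritten over unordered pairs.
  have key : ∀ H : {H : Fin n → Fin n → M // ∀ i j, H i j = H j i},
      sumLt H.1 = ∑ e : Sym2 (Fin n) with ¬ e.IsDiag, Sym2.lift H e := by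
    intro H
    have := Finset.sum_sym2_filter_not_isDiag Finset.univ (Sym2.lift H)
    rw [Finset.sym2_univ] at this
    rw [this, sumLt_eq_sum_filter]
    refine Finset.sum_congr ?_ fun p _ => by simp
    ext p
    simp only [Finset.mem_filter, Finset.mem_univ, true_and, Finset.mem_offDiag]
    exact ⟨fun h => ⟨h.ne, h⟩, fun h => h.2⟩
  rw [key ⟨F, hF⟩, key ⟨fun i j => F (π i) (π j), fun i j => hF _ _⟩]
  refine Finset.sum_bij' (fun e _ => Sym2.map π e) (fun e _ => Sym2.map π.symm e) ?_ ?_ ?_ ?_ ?_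
  · intro e; induction e with | _ a b => simp
  · intro e; induction e with | _ a b => simp
  · intro e; induction e with | _ a b => simp
  · intro e; induction e with | _ a b => simp
  · intro e; induction e with | _ a b => simp

/-- The quadratic form `∑_{ij ∈ E} x_i x_j`. -/
noncomputable def edgeForm {n : ℕ} (K : SimpleGraph (Fin n)) (x : Fin n → ZMod 2) : ZMod 2 :=
  sumLt fun i j => adjEntry K i j * x i * x j

open Classical in
theorem edgeForm_eq_sum {n : ℕ} (K : SimpleGraph (Fin n)) (x : Fin n → ZMod 2) :
    edgeForm K x = ∑ p : Fin n × Fin n with p.1 < p.2 ∧ K.Adj p.1 p.2, x p.1 * x p.2 := by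
  rw [edgeForm, sumLt_eq_sum_filter, ← Finset.filter_filter,
    Finset.sum_filter (s := Finset.univ.filter fun p : Fin n × Fin n => p.1 < p.2)]
  refine Finset.sum_congr rfl fun p _ => ?_
  simp [adjEntry]

theorem edgeForm_map {n : ℕ} (K : SimpleGraph (Fin n)) (π : Equiv.Perm (Fin n))
    (x : Fin n → ZMod 2) : edgeForm (K.map π.toEmbedding) x = edgeForm K (x ∘ π) := by
  rw [edgeForm, ← sumLt_perm _ (fun i j => ?_) π]
  · simp only [edgeForm, adjEntry_map, Function.comp]
  · rw [adjEntry_comm]; ring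

theorem edgeForm_add_single {n : ℕ} (K : SimpleGraph (Fin n)) (v : Fin n) (x : Fin n → ZMod 2)
    (a : ZMod 2) :
    edgeForm K (x + Pi.single v a) = edgeForm K x + a * ∑ j, adjEntry K v j * x j := by
  have h : a * ∑ j, adjEntry K v j * x j =
      sumLt fun i j => adjEntry K i j * (Pi.single v a : Fin n → ZMod 2) i * x j +
        adjEntry K j i * (Pi.single v a : Fin n → ZMod 2) j * x i := by
    rw [sumLt_add_swap (fun i j => adjEntry K i j * (Pi.single v a : Fin n → ZMod 2) i * x j)
      (fun i => by simp [adjEntry_self])]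
    symm
    rw [Finset.sum_eq_single v]
    · simp only [Pi.single_eq_same, Finset.mul_sum]
      exact Finset.sum_congr rfl fun j _ => by ring
    · intro i _ hi; simp [hi]
    · simp
  rw [h, edgeForm, edgeForm, ← sumLt_add]
  refine congrArg sumLt (funext fun i => funext fun j => ?_)
  have h0 : adjEntry K i j * (Pi.single v a : Fin n → ZMod 2) i *
      (Pi.single v a : Fin n → ZMod 2) j = 0 := by
    by_cases hi : i = v
    · by_cases hj : j = v
      · simp [hi, hj, adjEntry_self]
      · simp [hj]
    · simp [hi]
  rw [adjEntry_comm K j i, Pi.add_apply, Pi.add_apply]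
  linear_combination h0

theorem edgeForm_localComplement {n : ℕ} (K : SimpleGraph (Fin n)) (v : Fin n)
    (x : Fin n → ZMod 2) :
    edgeForm (localComplement K v) x =
      edgeForm K x + sumLt fun i j => adjEntry K v i * x i * (adjEntry K v j * x j) := by
  rw [edgeForm, edgeForm, ← sumLt_add]
  simp only [sumLt]
  refine Finset.sum_congr rfl fun i _ => Finset.sum_congr rfl fun j _ => ?_
  split_ifs with h
  · rw [adjEntry_localComplement, if_neg h.ne]; ring
  · rfl

theorem I_pow_val_add (a b : ZMod 2) :
    Complex.I ^ (a + b).val = sgn (a * b) * (Complex.I ^ a.val * Complex.I ^ b.val) := by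
  have h2 : (1 + 1 : ZMod 2) = 0 := rfl
  rcases zmod_two_eq a with rfl | rfl <;> rcases zmod_two_eq b with rfl | rfl <;>
    simp [sgn_zero, sgn_one, h2, ZMod.val_one]

/-- If y has weight w, the exponents of i add up to w, and w ≡ (w mod 2) + 2·C(w, 2) modulo 4. This
converts the complete graph on a neighbourhood into local phases. -/
theorem sgn_sumLt_mul_prod {n : ℕ} (y : Fin n → ZMod 2) :
    sgn (sumLt fun i j => y i * y j) * ∏ i, Complex.I ^ (y i).val =
      Complex.I ^ (∑ i, y i).val := by
  induction n with
  | zero => simp [sumLt, sgn_zero]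
  | succ n ih =>
    have h : (sumLt fun i j => y i * y j) =
        y 0 * ∑ i : Fin n, y i.succ + sumLt fun i j : Fin n => y i.succ * y j.succ := by
      simp [sumLt, Fin.sum_univ_succ, Finset.mul_sum]
    rw [h, Fin.prod_univ_succ, Fin.sum_univ_succ, I_pow_val_add, ← ih fun i => y i.succ, sgn_add]
    ring

/-! ### Invariance of the spectrum on the LC orbit -/

/-- The vector `2^(-n/2) (-1)^q`, where `q` is the quadratic form of the graph `K`. -/
noncomputable def graphState {n : ℕ} (K : SimpleGraph (Fin n)) : (Fin n → ZMod 2) → ℂ :=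
  signVector (edgeForm K)

theorem signVector_apply {n : ℕ} (f : (Fin n → ZMod 2) → ZMod 2) (x : Fin n → ZMod 2) :
    signVector f x = (((2 : ℝ) ^ (-(n : ℝ) / 2) : ℝ) : ℂ) * sgn (f x) := rfl

theorem tensor_mulVec_of_diagonal {n : ℕ} {W : Fin n → Matrix (ZMod 2) (ZMod 2) ℂ}
    (hW : ∀ i a b, a ≠ b → W i a b = 0) (s : (Fin n → ZMod 2) → ℂ) (x : Fin n → ZMod 2) :
    (tensor W *ᵥ s) x = (∏ i, W i (x i) (x i)) * s x := by
  simp only [Matrix.mulVec, dotProduct, tensor, Matrix.of_apply]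
  refine Finset.sum_eq_single x (fun y _ hy => ?_) (by simp)
  obtain ⟨i, hi⟩ := Function.ne_iff.mp hy
  rw [Finset.prod_eq_zero (Finset.mem_univ i) (hW i _ _ hi.symm), zero_mul]

/-- The linear term is a product of diagonal sign matrices, and the constant is a global sign. -/
theorem productSpectrum_signVector_add_affine_subset {n : ℕ} (f : (Fin n → ZMod 2) → ZMod 2)
    (b : Fin n → ZMod 2) (c : ZMod 2) :
    productSpectrum (signVector fun x => f x + (∑ i, b i * x i) + c) ⊆
      productSpectrum (signVector f) := by
  have h : (signVector fun x => f x + (∑ i, b i * x i) + c) =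
      sgn c • (tensor (fun i => Matrix.diagonal fun a => sgn (b i * a)) *ᵥ signVector f) := by
    funext x
    rw [Pi.smul_apply, tensor_mulVec_of_diagonal fun i a b h => Matrix.diagonal_apply_ne _ h]
    simp only [signVector_apply, sgn_add, sgn_sum, smul_eq_mul, Matrix.diagonal_apply_eq]
    ring
  rw [h]
  refine productSpectrum_smul_tensor_subset (fun i => ?_) (norm_sgn c) _
  exact preservesUnit_of_diagonal (by simp) (by simp) (by simp [norm_sgn]) (by simp [norm_sgn])

theorem productSpectrum_eq_of_corresponds {n : ℕ} {f : (Fin n → ZMod 2) → ZMod 2}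
    {K : SimpleGraph (Fin n)} (hf : Corresponds f K) :
    productSpectrum (signVector f) = productSpectrum (graphState K) := by
  obtain ⟨b, c, h⟩ := hf
  have h1 : f = fun x => edgeForm K x + (∑ i, b i * x i) + c := by
    funext x; rw [h, edgeForm_eq_sum]
  -- Adding an affine function is an involution in characteristic two, so one inclusion yields both.
  have h2 : edgeForm K = fun x => f x + (∑ i, b i * x i) + c := by
    have key : ∀ a b c : ZMod 2, a = a + b + c + b + c := by decide
    funext x; rw [h1]; exact key _ _ _
  refine Set.Subset.antisymm ?_ ?_
  · conv_lhs => rw [h1]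
    exact productSpectrum_signVector_add_affine_subset _ b c
  · rw [graphState]
    conv_lhs => rw [h2]
    exact productSpectrum_signVector_add_affine_subset _ b c

theorem tensor_mulVec_of_diagonal_off {n : ℕ} {W : Fin n → Matrix (ZMod 2) (ZMod 2) ℂ} (v : Fin n)
    (hW : ∀ i, i ≠ v → ∀ a b, a ≠ b → W i a b = 0) (s : (Fin n → ZMod 2) → ℂ)
    (x : Fin n → ZMod 2) :
    (tensor W *ᵥ s) x = ∑ a : ZMod 2,
      (∏ i, W i (x i) ((x + Pi.single v a : Fin n → ZMod 2) i)) * s (x + Pi.single v a) := by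
  simp only [Matrix.mulVec, dotProduct, tensor, Matrix.of_apply]
  refine (Fintype.sum_of_injective (fun a : ZMod 2 => x + Pi.single v a) ?_ _ _ ?_ ?_).symm
  · intro a b h
    simpa using h
  · intro y hy
    have : ∃ i, i ≠ v ∧ x i ≠ y i := by
      by_contra! hc
      refine hy ⟨y v - x v, ?_⟩
      funext i
      by_cases hi : i = v
      · subst hi; simp
      · simp [hi, hc i hi]
    obtain ⟨i, hi, hxy⟩ := this
    rw [Finset.prod_eq_zero (Finset.mem_univ i) (hW i hi _ _ hxy), zero_mul]
  · intro a; rfl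

/-- The local unitary taking the state of `K` to the state of the local complement at `v`. -/
noncomputable def lcMatrix {n : ℕ} (K : SimpleGraph (Fin n)) (v i : Fin n) :
    Matrix (ZMod 2) (ZMod 2) ℂ :=
  if i = v then flipRoot else Matrix.diagonal fun a => Complex.I ^ (adjEntry K v i * a).val

theorem preservesUnit_lcMatrix {n : ℕ} (K : SimpleGraph (Fin n)) (v i : Fin n) :
    PreservesUnit (lcMatrix K v i) := by
  unfold lcMatrix
  split_ifs
  · exact preservesUnit_flipRoot
  · exact preservesUnit_of_diagonal (by simp) (by simp) (by simp) (by simp)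

theorem prod_lcMatrix {n : ℕ} (K : SimpleGraph (Fin n)) (v : Fin n) (x : Fin n → ZMod 2)
    (a : ZMod 2) :
    ∏ i, lcMatrix K v i (x i) ((x + Pi.single v a : Fin n → ZMod 2) i) =
      ((Real.sqrt 2 : ℝ) : ℂ)⁻¹ * Complex.I ^ a.val *
        ∏ i, Complex.I ^ (adjEntry K v i * x i).val := by
  have h2 : ∀ a b : ZMod 2, a + (a + b) = b := by decide
  rw [← Finset.mul_prod_erase _ _ (Finset.mem_univ v),
    ← Finset.mul_prod_erase _ (fun i => Complex.I ^ (adjEntry K v i * x i).val)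
      (Finset.mem_univ v)]
  have : ∏ i ∈ Finset.univ.erase v, lcMatrix K v i (x i) ((x + Pi.single v a : Fin n → ZMod 2) i) =
      ∏ i ∈ Finset.univ.erase v, Complex.I ^ (adjEntry K v i * x i).val := by
    refine Finset.prod_congr rfl fun i hi => ?_
    have hi := Finset.ne_of_mem_erase hi
    simp [lcMatrix, hi]
  rw [this]
  simp [lcMatrix, flipRoot, h2, adjEntry_self]

/-- Flipping the bit at v multiplies the state by (-1)^L, where L is the parity of x on the
neighbourhood of v. The phases i on the neighbours produce the complemented edges times i^L, and i^L
(1 + i(-1)^L) = 1 + i whatever L is. Only the global phase (1 + i)/√2 remains, and the scalar in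
front cancels it. -/
theorem graphState_localComplement {n : ℕ} (K : SimpleGraph (Fin n)) (v : Fin n) :
    graphState (localComplement K v) =
      (((Real.sqrt 2 : ℝ) : ℂ)⁻¹ * (1 - Complex.I)) •
        (tensor (lcMatrix K v) *ᵥ graphState K) := by
  funext x
  have hdiag : ∀ i, i ≠ v → ∀ a b, a ≠ b → lcMatrix K v i a b = 0 := by
    intro i hi a b hab
    simp [lcMatrix, hi, hab]
  rw [Pi.smul_apply, tensor_mulVec_of_diagonal_off v hdiag]
  simp only [prod_lcMatrix, graphState, signVector_apply, edgeForm_add_single, sgn_add]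
  rw [sum_zmod_two, edgeForm_localComplement, sgn_add]
  have h := sgn_sumLt_mul_prod fun i => adjEntry K v i * x i
  set D := ∏ i, Complex.I ^ (adjEntry K v i * x i).val
  set L := ∑ j, adjEntry K v j * x j
  set e := sgn (sumLt fun i j => adjEntry K v i * x i * (adjEntry K v j * x j))
  have hee : e * e = 1 := sgn_mul_self _
  have hD : D = e * Complex.I ^ L.val := by rw [← h, ← mul_assoc, hee, one_mul]
  have hr : ((Real.sqrt 2 : ℝ) : ℂ)⁻¹ * ((Real.sqrt 2 : ℝ) : ℂ)⁻¹ = 1 / 2 := by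
    rw [← mul_inv, ← Complex.ofReal_mul, Real.mul_self_sqrt zero_le_two]; norm_num
  have hL : Complex.I ^ L.val * (1 + Complex.I * sgn L) * (1 - Complex.I) = 2 := by
    have hI := Complex.I_mul_I
    rcases zmod_two_eq L with h | h <;> rw [h] <;> simp [sgn_zero, sgn_one, ZMod.val_one]
    · linear_combination -hI
    · linear_combination (Complex.I - 2) * hI
  rw [hD]
  simp only [ZMod.val_zero, ZMod.val_one, zero_mul, one_mul, pow_zero, pow_one, sgn_zero, mul_one,
    smul_eq_mul]
  set r := ((Real.sqrt 2 : ℝ) : ℂ)⁻¹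
  set N : ℂ := (((2 : ℝ) ^ (-(n : ℝ) / 2) : ℝ) : ℂ)
  set q := sgn (edgeForm K x)
  linear_combination
    (-(N * q * e * (Complex.I ^ L.val * (1 + Complex.I * sgn L) * (1 - Complex.I)))) * hr
      - (N * q * e / 2) * hL

theorem productSpectrum_localComplement {n : ℕ} (K : SimpleGraph (Fin n)) (v : Fin n) :
    productSpectrum (graphState (localComplement K v)) = productSpectrum (graphState K) := by
  have key : ∀ K : SimpleGraph (Fin n),
      productSpectrum (graphState (localComplement K v)) ⊆ productSpectrum (graphState K) := by
    intro K
    rw [graphState_localComplement]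
    refine productSpectrum_smul_tensor_subset (preservesUnit_lcMatrix K v) ?_ _
    have h : ‖((Real.sqrt 2 : ℝ) : ℂ)⁻¹ * (1 - Complex.I)‖ ^ 2 = 1 := by
      have h1 : ‖(1 : ℂ) - Complex.I‖ ^ 2 = 2 := by
        rw [← Complex.normSq_eq_norm_sq]; simp [Complex.normSq_apply]; norm_num
      rw [norm_mul, mul_pow, norm_inv_sqrt_two_sq, h1]; norm_num
    exact (pow_eq_one_iff_of_nonneg (norm_nonneg _) two_ne_zero).mp h
  refine (key K).antisymm ?_
  conv_lhs => rw [← localComplement_localComplement K v]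
  exact key _

theorem productSpectrum_map {n : ℕ} (K : SimpleGraph (Fin n)) (π : Equiv.Perm (Fin n)) :
    productSpectrum (graphState (K.map π.toEmbedding)) = productSpectrum (graphState K) := by
  have key : ∀ (K : SimpleGraph (Fin n)) (π : Equiv.Perm (Fin n)),
      productSpectrum (graphState (K.map π.toEmbedding)) ⊆ productSpectrum (graphState K) := by
    rintro K π r ⟨v, hv, rfl⟩
    refine ⟨fun i => v (π i), fun i => hv _, ?_⟩
    congr 3
    refine Fintype.sum_equiv (Equiv.arrowCongr π.symm (Equiv.refl _)) _ _ fun x => ?_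
    simp only [graphState, signVector_apply, edgeForm_map]
    congr 1
    rw [← Equiv.prod_comp π]
    rfl
  refine (key K π).antisymm ?_
  conv_lhs => rw [← map_map_symm K π]
  exact key _ _

theorem productSpectrum_of_mem_lcOrbit {n : ℕ} {G K : SimpleGraph (Fin n)} (h : K ∈ lcOrbit G) :
    productSpectrum (graphState K) = productSpectrum (graphState G) := by
  induction (h : Relation.ReflTransGen LCStep K G) with
  | refl => rfl
  | tail _ h ih =>
    rw [ih]
    rcases h with ⟨v, rfl⟩ | ⟨π, rfl⟩
    · exact (productSpectrum_localComplement _ v).symm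
    · exact (productSpectrum_map _ π).symm

/-! ### Lower bound from independent sets -/

theorem two_pow_mul_norm_sq {n : ℕ} (z : ℂ) :
    2 ^ n * ‖(((2 : ℝ) ^ (-(n : ℝ) / 2) : ℝ) : ℂ) * z‖ ^ 2 = ‖z‖ ^ 2 := by
  have h : ((2 : ℝ) ^ (-(n : ℝ) / 2)) ^ 2 = (2 ^ n)⁻¹ := by
    rw [← Real.rpow_natCast, ← Real.rpow_mul zero_le_two]
    simp [Real.rpow_neg]
  rw [norm_mul, Complex.norm_real, mul_pow, Real.norm_eq_abs, sq_abs, h, ← mul_assoc,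
    mul_inv_cancel₀ (by positivity), one_mul]

theorem two_pow_indepNum_mem_productSpectrum {n : ℕ} (K : SimpleGraph (Fin n)) :
    (2 : ℝ) ^ K.indepNum ∈ productSpectrum (graphState K) := by
  classical
  obtain ⟨T, hT⟩ := K.exists_isNIndepSet_indepNum
  let r : ℂ := ((Real.sqrt 2 : ℝ) : ℂ)⁻¹
  let v : Fin n → ZMod 2 → ℂ := fun i a => if i ∈ T then r else if a = 0 then 1 else 0
  refine ⟨v, fun i => ?_, ?_⟩
  · by_cases hi : i ∈ T
    · simp only [IsUnitVec, v, hi, if_true, r, norm_inv_sqrt_two_sq]; norm_num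
    · simp [IsUnitVec, v, hi]
  · have h1 : overlap v (graphState K) =
        (((2 : ℝ) ^ (-(n : ℝ) / 2) : ℝ) : ℂ) * ∑ x : Fin n → ZMod 2, ∏ i, v i (x i) := by
      rw [overlap, Finset.mul_sum]
      refine Finset.sum_congr rfl fun x _ => ?_
      -- Words supported in T carry sign +1 because T has no edges; all other words have zero weight
      -- in v.
      by_cases hx : ∀ i, i ∉ T → x i = 0
      · have : edgeForm K x = 0 := by
          unfold edgeForm sumLt
          refine Finset.sum_eq_zero fun i _ => Finset.sum_eq_zero fun j _ => ?_
          split_ifs with hij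
          · by_cases hi : i ∈ T
            · by_cases hj : j ∈ T
              · simp [adjEntry_eq_zero.mpr (hT.isIndepSet hi hj hij.ne)]
              · simp [hx j hj]
            · simp [hx i hi]
          · rfl
        rw [graphState, signVector_apply, this, sgn_zero]; ring
      · push Not at hx
        obtain ⟨i, hi, hxi⟩ := hx
        rw [Finset.prod_eq_zero (Finset.mem_univ i) (by simp [v, hi, hxi])]; simp
    have h2 : ∑ x : Fin n → ZMod 2, ∏ i, v i (x i) = ((Real.sqrt 2 : ℝ) : ℂ) ^ T.card := by
      have := Finset.prod_univ_sum (fun _ : Fin n => (Finset.univ : Finset (ZMod 2))) v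
      rw [Fintype.piFinset_univ] at this
      rw [← this]
      have hr : r + r = ((Real.sqrt 2 : ℝ) : ℂ) := by
        rw [← two_mul]
        have h0 : ((Real.sqrt 2 : ℝ) : ℂ) ≠ 0 := by simp
        have h3 : ((Real.sqrt 2 : ℝ) : ℂ) * ((Real.sqrt 2 : ℝ) : ℂ) = 2 := by
          rw [← Complex.ofReal_mul, Real.mul_self_sqrt zero_le_two]; norm_num
        rw [← h3, mul_assoc, mul_inv_cancel₀ h0, mul_one]
      have h4 : ∀ i, ∑ a, v i a = if i ∈ T then ((Real.sqrt 2 : ℝ) : ℂ) else 1 := by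
        intro i
        rw [sum_zmod_two]
        by_cases hi : i ∈ T <;> simp [v, hi, hr]
      simp only [h4, Finset.prod_ite_mem, Finset.univ_inter, Finset.prod_const]
    rw [h1, two_pow_mul_norm_sq, h2, norm_pow, Complex.norm_real,
      Real.norm_of_nonneg (Real.sqrt_nonneg 2), ← pow_mul, mul_comm, pow_mul,
      Real.sq_sqrt zero_le_two, hT.card_eq]

/-! ### A min-max theorem for submodular functions -/

/-- Elements of J are assigned one at a time to S₁ or to S₂ while the hypothesis is kept. If neither
choice for e works, the two violating sets uncross by submodularity into A ∪ B ∪ {e} and A ∩ B,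
contradicting the hypothesis. -/
theorem exists_le_rank_add_rank_sdiff {α : Type*} [DecidableEq α] {r : Finset α → ℤ}
    (hmono : ∀ A B, A ⊆ B → r A ≤ r B) (hsub : ∀ A B, r (A ∪ B) + r (A ∩ B) ≤ r A + r B) (t : ℤ)
    (J S₁ S₂ : Finset α)
    (ht : ∀ A ⊆ J, t ≤ (J \ A).card + r (A ∪ S₁) + r (A ∪ S₂)) :
    ∃ T ⊆ J, t ≤ r (T ∪ S₁) + r ((J \ T) ∪ S₂) := by
  induction J using Finset.induction_on generalizing S₁ S₂ with
  | empty => exact ⟨∅, subset_rfl, by simpa using ht ∅ subset_rfl⟩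
  | insert e J he ih =>
    by_cases h₁ : ∀ A ⊆ J, t ≤ (J \ A).card + r (A ∪ insert e S₁) + r (A ∪ S₂)
    · obtain ⟨T, hT, h⟩ := ih _ _ h₁
      refine ⟨insert e T, Finset.insert_subset_insert e hT, ?_⟩
      rw [Finset.insert_sdiff_insert, Finset.sdiff_insert_of_notMem he, Finset.insert_union,
        ← Finset.union_insert]
      exact h
    by_cases h₂ : ∀ A ⊆ J, t ≤ (J \ A).card + r (A ∪ S₁) + r (A ∪ insert e S₂)
    · obtain ⟨T, hT, h⟩ := ih _ _ h₂
      refine ⟨T, hT.trans (Finset.subset_insert e J), ?_⟩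
      rw [Finset.insert_sdiff_of_notMem _ fun h => he (hT h), Finset.insert_union,
        ← Finset.union_insert]
      exact h
    exfalso
    push Not at h₁ h₂
    obtain ⟨A, hA, hA'⟩ := h₁
    obtain ⟨B, hB, hB'⟩ := h₂
    have hU := ht (insert e (A ∪ B)) (Finset.insert_subset_insert e (Finset.union_subset hA hB))
    have hI := ht (A ∩ B) ((Finset.inter_subset_left.trans hA).trans (Finset.subset_insert e J))
    have s₁ := hsub (A ∪ insert e S₁) (B ∪ S₁)
    have s₂ := hsub (B ∪ insert e S₂) (A ∪ S₂)
    have u₁ : (A ∪ insert e S₁) ∪ (B ∪ S₁) = insert e (A ∪ B) ∪ S₁ := by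
      ext; simp; tauto
    have u₂ : (B ∪ insert e S₂) ∪ (A ∪ S₂) = insert e (A ∪ B) ∪ S₂ := by
      ext; simp; tauto
    have i₁ : r (A ∩ B ∪ S₁) ≤ r ((A ∪ insert e S₁) ∩ (B ∪ S₁)) :=
      hmono _ _ fun x => by simp; tauto
    have i₂ : r (A ∩ B ∪ S₂) ≤ r ((B ∪ insert e S₂) ∩ (A ∪ S₂)) :=
      hmono _ _ fun x => by simp; tauto
    rw [u₁] at s₁
    rw [u₂] at s₂
    rw [Finset.insert_sdiff_insert, Finset.sdiff_insert_of_notMem he] at hU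
    have heAB : e ∉ A ∩ B := fun h => he (hA (Finset.mem_inter.mp h).1)
    -- Here e costs one extra unit, but the two strict integer violations together gain two.
    rw [Finset.insert_sdiff_of_notMem _ heAB, Finset.card_insert_of_notMem
      (fun h => he (Finset.mem_sdiff.mp h).1)] at hI
    have hc : (J \ (A ∪ B)).card + (J \ (A ∩ B)).card = (J \ A).card + (J \ B).card := by
      have hd : J \ (A ∩ B) = J \ A ∪ J \ B := by ext; simp; tauto
      rw [Finset.sdiff_union_distrib, hd, add_comm, Finset.card_union_add_card_inter]
    push_cast at hI
    omega

/-! ### Codes and overlaps with their indicators -/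

/-- The words of the code `C` that vanish on `A`. -/
def vanishing {n : ℕ} (C : Submodule (ZMod 2) (Fin n → ZMod 2)) (A : Finset (Fin n)) :
    Submodule (ZMod 2) (Fin n → ZMod 2) where
  carrier := {c | c ∈ C ∧ ∀ i ∈ A, c i = 0}
  add_mem' := fun ha hb => ⟨C.add_mem ha.1 hb.1, fun i hi => by simp [ha.2 i hi, hb.2 i hi]⟩
  zero_mem' := ⟨C.zero_mem, fun _ _ => rfl⟩
  smul_mem' := fun a _ hc => ⟨C.smul_mem a hc.1, fun i hi => by simp [hc.2 i hi]⟩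

theorem mem_vanishing {n : ℕ} {C : Submodule (ZMod 2) (Fin n → ZMod 2)} {A : Finset (Fin n)}
    {c : Fin n → ZMod 2} : c ∈ vanishing C A ↔ c ∈ C ∧ ∀ i ∈ A, c i = 0 := Iff.rfl

theorem vanishing_anti {n : ℕ} (C : Submodule (ZMod 2) (Fin n → ZMod 2)) {A B : Finset (Fin n)}
    (h : A ⊆ B) : vanishing C B ≤ vanishing C A :=
  fun _ hc => ⟨hc.1, fun i hi => hc.2 i (h hi)⟩

theorem finrank_vanishing_supermodular {n : ℕ} (C : Submodule (ZMod 2) (Fin n → ZMod 2))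
    (A B : Finset (Fin n)) :
    Module.finrank (ZMod 2) (vanishing C A) + Module.finrank (ZMod 2) (vanishing C B) ≤
      Module.finrank (ZMod 2) (vanishing C (A ∪ B)) +
        Module.finrank (ZMod 2) (vanishing C (A ∩ B)) := by
  have hinf : vanishing C (A ∪ B) = vanishing C A ⊓ vanishing C B := by
    ext c
    simp only [Submodule.mem_inf, mem_vanishing, Finset.mem_union]
    constructor
    · rintro ⟨hc, h⟩
      exact ⟨⟨hc, fun i hi => h i (Or.inl hi)⟩, hc, fun i hi => h i (Or.inr hi)⟩
    · rintro ⟨⟨hc, h⟩, -, h'⟩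
      exact ⟨hc, fun i hi => hi.elim (h i) (h' i)⟩
  have hsup : vanishing C A ⊔ vanishing C B ≤ vanishing C (A ∩ B) :=
    sup_le (vanishing_anti C Finset.inter_subset_left) (vanishing_anti C Finset.inter_subset_right)
  rw [hinf, ← Submodule.finrank_sup_add_finrank_inf_eq, add_comm]
  exact Nat.add_le_add_left (Submodule.finrank_mono hsup) _

open Classical in
theorem card_fiber_le {n : ℕ} (C : Submodule (ZMod 2) (Fin n → ZMod 2)) (S : Finset (Fin n))
    (z : S → ZMod 2) :
    (Finset.univ.filter fun c : Fin n → ZMod 2 => c ∈ C ∧ (fun i : S => c i) = z).card ≤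
      2 ^ Module.finrank (ZMod 2) (vanishing C S) := by
  have hcard : (2 : ℕ) ^ Module.finrank (ZMod 2) (vanishing C S) =
      (Finset.univ.filter fun c : Fin n → ZMod 2 => c ∈ vanishing C S).card := by
    have := Module.card_eq_pow_finrank (K := ZMod 2) (V := vanishing C S)
    rw [ZMod.card] at this
    rw [← this, Fintype.card_subtype]
  rw [hcard]
  rcases Finset.eq_empty_or_nonempty
    (Finset.univ.filter fun c : Fin n → ZMod 2 => c ∈ C ∧ (fun i : S => c i) = z) with h | ⟨c₀, h⟩
  · simp [h]
  · simp only [Finset.mem_filter, Finset.mem_univ, true_and] at h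
    refine Finset.card_le_card_of_injOn (fun c => c - c₀) ?_ (fun a _ b _ hab => by simpa using hab)
    intro c hc
    simp only [Finset.coe_filter, Finset.mem_univ, true_and, Set.mem_ofPred_eq] at hc ⊢
    refine ⟨C.sub_mem hc.1 h.1, fun i hi => ?_⟩
    have := congrFun (hc.2.trans h.2.symm) ⟨i, hi⟩
    simpa [sub_eq_zero] using this

-- The product of the p i over S is a probability distribution on words indexed by S, and each fibre
-- of the restriction of C to S is empty or a coset of the subcode vanishing on S.
open Classical in
theorem sum_code_prod_le {n : ℕ} (C : Submodule (ZMod 2) (Fin n → ZMod 2)) (S : Finset (Fin n))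
    {p : Fin n → ZMod 2 → ℝ} (hp : ∀ i a, 0 ≤ p i a) (hp1 : ∀ i, p i 0 + p i 1 = 1) :
    ∑ c : Fin n → ZMod 2 with c ∈ C, ∏ i ∈ S, p i (c i) ≤
      2 ^ Module.finrank (ZMod 2) (vanishing C S) := by
  have h1 : ∑ z : S → ZMod 2, ∏ i : S, p i (z i) = 1 := by
    have := Finset.prod_univ_sum (fun _ : S => (Finset.univ : Finset (ZMod 2)))
      (fun (i : S) a => p i a)
    rw [Fintype.piFinset_univ] at this
    rw [← this]
    exact Finset.prod_eq_one fun i _ => by rw [sum_zmod_two, hp1]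
  rw [← Finset.sum_fiberwise _ (fun c : Fin n → ZMod 2 => fun i : S => c i)]
  calc _ = ∑ z : S → ZMod 2, ((Finset.univ.filter fun c : Fin n → ZMod 2 =>
        c ∈ C ∧ (fun i : S => c i) = z).card : ℝ) * ∏ i : S, p i (z i) := by
        refine Finset.sum_congr rfl fun z _ => ?_
        rw [Finset.filter_filter, ← nsmul_eq_mul]
        refine Finset.sum_eq_card_nsmul fun c hc => ?_
        simp only [Finset.mem_filter, Finset.mem_univ, true_and] at hc
        rw [← Finset.prod_coe_sort, ← hc.2]
    _ ≤ ∑ z : S → ZMod 2, (2 : ℝ) ^ Module.finrank (ZMod 2) (vanishing C S) *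
          ∏ i : S, p i (z i) := by
        refine Finset.sum_le_sum fun z _ => ?_
        refine mul_le_mul_of_nonneg_right ?_ (Finset.prod_nonneg fun i _ => hp _ _)
        exact_mod_cast card_fiber_le C S z
    _ = _ := by rw [← Finset.mul_sum, h1, mul_one]

open Classical in
/-- The indicator function of a code. -/
noncomputable def codeIndicator {n : ℕ} (C : Submodule (ZMod 2) (Fin n → ZMod 2)) :
    (Fin n → ZMod 2) → ℂ :=
  fun c => if c ∈ C then 1 else 0

/-- Cauchy–Schwarz separates the factors in S from those in Sᶜ; the squared moduli at each position
sum to 1. -/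
theorem norm_overlap_codeIndicator_sq_le {n : ℕ} (C : Submodule (ZMod 2) (Fin n → ZMod 2))
    (S : Finset (Fin n)) {v : Fin n → ZMod 2 → ℂ} (hv : ∀ i, IsUnitVec (v i)) :
    ‖overlap v (codeIndicator C)‖ ^ 2 ≤
      2 ^ (Module.finrank (ZMod 2) (vanishing C S) +
        Module.finrank (ZMod 2) (vanishing C Sᶜ)) := by
  classical
  have h1 : ‖overlap v (codeIndicator C)‖ ≤
      ∑ c : Fin n → ZMod 2 with c ∈ C, (∏ i ∈ S, ‖v i (c i)‖) * ∏ i ∈ Sᶜ, ‖v i (c i)‖ := by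
    rw [Finset.sum_filter]
    refine (norm_sum_le _ _).trans (Finset.sum_le_sum fun c _ => ?_)
    rw [Finset.prod_mul_prod_compl]
    by_cases hc : c ∈ C <;> simp [codeIndicator, hc]
  calc _ ≤ _ := pow_le_pow_left₀ (norm_nonneg _) h1 2
    _ ≤ (∑ c : Fin n → ZMod 2 with c ∈ C, (∏ i ∈ S, ‖v i (c i)‖) ^ 2) *
        ∑ c : Fin n → ZMod 2 with c ∈ C, (∏ i ∈ Sᶜ, ‖v i (c i)‖) ^ 2 :=
      Finset.sum_mul_sq_le_sq_mul_sq _ _ _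
    _ ≤ _ := by
      simp only [← Finset.prod_pow]
      rw [pow_add]
      refine mul_le_mul ?_ ?_ (by positivity) (by positivity)
      · exact sum_code_prod_le C S (p := fun i a => ‖v i a‖ ^ 2) (fun _ _ => by positivity) hv
      · exact sum_code_prod_le C Sᶜ (p := fun i a => ‖v i a‖ ^ 2) (fun _ _ => by positivity) hv

/-! ### Bipartite graph states as codes -/

/-- Every edge of `B` joins `X` to its complement. -/
def IsSide {n : ℕ} (B : SimpleGraph (Fin n)) (X : Finset (Fin n)) : Prop :=
  ∀ a b, B.Adj a b → (a ∈ X ↔ b ∉ X)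

theorem exists_isSide {n : ℕ} {B : SimpleGraph (Fin n)} (h : B.IsBipartite) :
    ∃ X, IsSide B X := by
  obtain ⟨col⟩ := h
  refine ⟨Finset.univ.filter fun i => col i = 0, fun a b hab => ?_⟩
  have := col.valid hab
  simp only [Finset.mem_filter, Finset.mem_univ, true_and]
  generalize col a = p at *
  generalize col b = q at *
  revert this
  revert p q
  decide

theorem IsSide.adjEntry_eq_zero {n : ℕ} {B : SimpleGraph (Fin n)} {X : Finset (Fin n)}
    (h : IsSide B X) {a b : Fin n} (hab : ¬ (a ∈ X ↔ b ∉ X)) : adjEntry B a b = 0 :=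
  BipartiteLC.adjEntry_eq_zero.mpr fun h' => hab (h a b h')

/-- The binary code whose information set is the side `X` of the bipartite graph `B` and whose
check digits are given by the edges. -/
def bipartiteCode {n : ℕ} (B : SimpleGraph (Fin n)) (X : Finset (Fin n)) :
    Submodule (ZMod 2) (Fin n → ZMod 2) where
  carrier := {c | ∀ y ∉ X, c y = ∑ x, adjEntry B y x * c x}
  add_mem' := fun ha hb y hy => by
    simp only [Pi.add_apply, mul_add, Finset.sum_add_distrib, ha y hy, hb y hy]
  zero_mem' := fun y _ => by simp
  smul_mem' := fun a c hc y hy => by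
    simp only [Pi.smul_apply, smul_eq_mul, hc y hy, Finset.mul_sum]
    exact Finset.sum_congr rfl fun x _ => by ring

theorem mem_bipartiteCode {n : ℕ} {B : SimpleGraph (Fin n)} {X : Finset (Fin n)}
    {c : Fin n → ZMod 2} :
    c ∈ bipartiteCode B X ↔ ∀ y ∉ X, c y = ∑ x, adjEntry B y x * c x := Iff.rfl

theorem IsSide.sum_adjEntry_congr {n : ℕ} {B : SimpleGraph (Fin n)} {X : Finset (Fin n)}
    (h : IsSide B X) {y : Fin n} (hy : y ∉ X) {c c' : Fin n → ZMod 2}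
    (hc : ∀ i ∈ X, c i = c' i) :
    ∑ x, adjEntry B y x * c x = ∑ x, adjEntry B y x * c' x := by
  refine Finset.sum_congr rfl fun x _ => ?_
  by_cases hx : x ∈ X
  · rw [hc x hx]
  · rw [h.adjEntry_eq_zero (by tauto), zero_mul, zero_mul]

theorem IsSide.eq_of_mem_bipartiteCode {n : ℕ} {B : SimpleGraph (Fin n)} {X : Finset (Fin n)}
    (h : IsSide B X) {c c' : Fin n → ZMod 2} (hc : c ∈ bipartiteCode B X)
    (hc' : c' ∈ bipartiteCode B X) (hcc : ∀ i ∈ X, c i = c' i) : c = c' := by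
  funext y
  by_cases hy : y ∈ X
  · exact hcc y hy
  · rw [hc y hy, hc' y hy, h.sum_adjEntry_congr hy hcc]

theorem IsSide.finrank_vanishing_le {n : ℕ} {B : SimpleGraph (Fin n)} {X : Finset (Fin n)}
    (h : IsSide B X) (A : Finset (Fin n)) :
    Module.finrank (ZMod 2) (vanishing (bipartiteCode B X) A) ≤ (X \ A).card := by
  let φ : vanishing (bipartiteCode B X) A →ₗ[ZMod 2] ((X \ A : Finset (Fin n)) → ZMod 2) :=
    (LinearMap.funLeft (ZMod 2) (ZMod 2) Subtype.val).comp (Submodule.subtype _)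
  have hφ : Function.Injective φ := by
    rintro ⟨c, hc⟩ ⟨c', hc'⟩ hcc
    refine Subtype.ext (h.eq_of_mem_bipartiteCode hc.1 hc'.1 fun i hi => ?_)
    by_cases hA : i ∈ A
    · exact (hc.2 i hA).trans (hc'.2 i hA).symm
    · exact congrFun hcc ⟨i, Finset.mem_sdiff.mpr ⟨hi, hA⟩⟩
  have := LinearMap.finrank_le_finrank_of_injective hφ
  rwa [Module.finrank_fintype_fun_eq_card, Fintype.card_coe] at this

/-- Each edge has exactly one end outside X and is counted from that end. -/
theorem IsSide.edgeForm_eq {n : ℕ} {B : SimpleGraph (Fin n)} {X : Finset (Fin n)}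
    (h : IsSide B X) (x : Fin n → ZMod 2) :
    edgeForm B x = ∑ i ∈ Xᶜ, x i * ∑ j, adjEntry B i j * x j := by
  have h1 : edgeForm B x = sumLt fun i j =>
      (if i ∈ X then 0 else adjEntry B i j * x i * x j) +
        (if j ∈ X then 0 else adjEntry B j i * x j * x i) := by
    refine congrArg sumLt (funext fun i => funext fun j => ?_)
    rw [adjEntry_comm B j i]
    by_cases hi : i ∈ X <;> by_cases hj : j ∈ X
    · simp [hi, hj, h.adjEntry_eq_zero (a := i) (b := j) (by tauto)]
    · simp [hi, hj]; ring
    · simp [hi, hj]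
    · simp [hi, hj, h.adjEntry_eq_zero (a := i) (b := j) (by tauto)]
  rw [h1, sumLt_add_swap (fun i j => if i ∈ X then 0 else adjEntry B i j * x i * x j)
    (fun i => by simp [adjEntry_self]), ← Finset.sum_add_sum_compl X]
  rw [Finset.sum_eq_zero (s := X) (fun i hi => by simp [hi]), zero_add]
  refine Finset.sum_congr rfl fun i hi => ?_
  rw [Finset.mul_sum]
  refine Finset.sum_congr rfl fun j _ => ?_
  rw [if_neg (Finset.mem_compl.mp hi)]; ring

/-- Hadamard matrices at the positions outside `X`. -/
noncomputable def sideMatrix {n : ℕ} (X : Finset (Fin n)) (i : Fin n) :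
    Matrix (ZMod 2) (ZMod 2) ℂ :=
  if i ∈ X then 1 else hadamard

theorem preservesUnit_sideMatrix {n : ℕ} (X : Finset (Fin n)) (i : Fin n) :
    PreservesUnit (sideMatrix X i) := by
  unfold sideMatrix
  split_ifs
  · exact preservesUnit_of_diagonal (by simp) (by simp) (by simp) (by simp)
  · exact preservesUnit_hadamard

theorem IsSide.tensor_sideMatrix_mulVec {n : ℕ} {B : SimpleGraph (Fin n)} {X : Finset (Fin n)}
    (h : IsSide B X) (x : Fin n → ZMod 2) :
    (tensor (sideMatrix X) *ᵥ codeIndicator (bipartiteCode B X)) x =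
      ((Real.sqrt 2 : ℝ) : ℂ)⁻¹ ^ Xᶜ.card * sgn (edgeForm B x) := by
  -- Among the words d in the sum only the codeword extending the restriction of x to X contributes:
  -- the identity factors force d = x on X, and X is an information set.
  let c : Fin n → ZMod 2 := fun i => if i ∈ X then x i else ∑ j, adjEntry B i j * x j
  have hcX : ∀ i ∈ X, c i = x i := fun i hi => by simp [c, hi]
  have hcY : ∀ i, i ∉ X → c i = ∑ j, adjEntry B i j * x j := fun i hi => by simp [c, hi]
  have hc : c ∈ bipartiteCode B X := fun y hy => by
    rw [hcY y hy, h.sum_adjEntry_congr hy hcX]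
  simp only [Matrix.mulVec, dotProduct, tensor, Matrix.of_apply]
  rw [Finset.sum_eq_single c]
  · rw [codeIndicator, if_pos hc, mul_one, ← Finset.prod_mul_prod_compl X,
      Finset.prod_eq_one (s := X) (fun i hi => by rw [hcX i hi]; simp [sideMatrix, hi]), one_mul,
      h.edgeForm_eq, sgn_sum, ← Finset.prod_const, ← Finset.prod_mul_distrib]
    refine Finset.prod_congr rfl fun i hi => ?_
    have hi := Finset.mem_compl.mp hi
    rw [sideMatrix, if_neg hi, hcY i hi]
    rfl
  · intro d _ hd
    by_cases hdC : d ∈ bipartiteCode B X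
    · have : ∃ i ∈ X, d i ≠ x i := by
        by_contra! hdx
        exact hd (h.eq_of_mem_bipartiteCode hdC hc fun i hi => (hdx i hi).trans (hcX i hi).symm)
      obtain ⟨i, hi, hne⟩ := this
      rw [Finset.prod_eq_zero (Finset.mem_univ i) (by simp [sideMatrix, hi, hne.symm]), zero_mul]
    · simp [codeIndicator, hdC]
  · simp

theorem IsSide.le_of_mem_productSpectrum {n : ℕ} {B : SimpleGraph (Fin n)} {X : Finset (Fin n)}
    (h : IsSide B X) (S : Finset (Fin n)) {r : ℝ} (hr : r ∈ productSpectrum (graphState B)) :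
    r ≤ 2 ^ (Xᶜ.card + (Module.finrank (ZMod 2) (vanishing (bipartiteCode B X) S) +
        Module.finrank (ZMod 2) (vanishing (bipartiteCode B X) Sᶜ))) := by
  obtain ⟨v, hv, rfl⟩ := hr
  have hs0 : ((Real.sqrt 2 : ℝ) : ℂ) ≠ 0 := by simp
  have h1 : overlap v (graphState B) = (((2 : ℝ) ^ (-(n : ℝ) / 2) : ℝ) : ℂ) *
      (((Real.sqrt 2 : ℝ) : ℂ) ^ Xᶜ.card *
        overlap v (tensor (sideMatrix X) *ᵥ codeIndicator (bipartiteCode B X))) := by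
    simp only [overlap, Finset.mul_sum]
    refine Finset.sum_congr rfl fun x _ => ?_
    rw [h.tensor_sideMatrix_mulVec, graphState, signVector_apply]
    have : ((Real.sqrt 2 : ℝ) : ℂ) ^ Xᶜ.card * ((Real.sqrt 2 : ℝ) : ℂ)⁻¹ ^ Xᶜ.card = 1 := by
      rw [← mul_pow, mul_inv_cancel₀ hs0, one_pow]
    linear_combination (-(((2 : ℝ) ^ (-(n : ℝ) / 2) : ℝ) : ℂ) * (∏ i, v i (x i)) *
      sgn (edgeForm B x)) * this
  rw [h1, two_pow_mul_norm_sq, norm_mul, mul_pow, norm_pow, Complex.norm_real,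
    Real.norm_of_nonneg (Real.sqrt_nonneg 2), ← pow_mul, mul_comm _ 2, pow_mul,
    Real.sq_sqrt zero_le_two, pow_add, overlap_tensor_mulVec]
  refine mul_le_mul_of_nonneg_left ?_ (by positivity)
  exact norm_overlap_codeIndicator_sq_le _ S fun i => preservesUnit_sideMatrix X i _ (hv i)

/-! ### Pivoting as a change of information set -/

/-- The pivot of a graph along the edge `u v`. -/
def pivot {n : ℕ} (B : SimpleGraph (Fin n)) (u v : Fin n) : SimpleGraph (Fin n) :=
  localComplement (localComplement (localComplement B u) v) u

theorem adjEntry_localComplement_of_ne {n : ℕ} (K : SimpleGraph (Fin n)) (v : Fin n) {i j : Fin n}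
    (hij : i ≠ j) :
    adjEntry (localComplement K v) i j = adjEntry K i j + adjEntry K v i * adjEntry K v j := by
  rw [adjEntry_localComplement, if_neg hij]

section Pivot

variable {n : ℕ} {B : SimpleGraph (Fin n)} {u v : Fin n}

theorem adjEntry_localComplement_localComplement_left (huv : B.Adj u v) {j : Fin n} (hju : j ≠ u)
    (hjv : j ≠ v) :
    adjEntry (localComplement (localComplement B u) v) u j = adjEntry B v j := by
  have huv1 : adjEntry B u v = 1 := adjEntry_eq_one.mpr huv
  have h : ∀ a b : ZMod 2, a + (b + a) = b := by decide
  rw [adjEntry_localComplement_of_ne _ _ hju.symm, adjEntry_localComplement_left,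
    adjEntry_comm _ v u, adjEntry_localComplement_left, huv1, one_mul,
    adjEntry_localComplement_of_ne _ _ hjv.symm, huv1, one_mul, h]

theorem adjEntry_localComplement_localComplement_right (huv : B.Adj u v) {j : Fin n}
    (hjv : j ≠ v) :
    adjEntry (localComplement (localComplement B u) v) v j = adjEntry B v j + adjEntry B u j := by
  rw [adjEntry_localComplement_left, adjEntry_localComplement_of_ne _ _ hjv.symm,
    adjEntry_eq_one.mpr huv, one_mul]

theorem adjEntry_localComplement_localComplement_edge (huv : B.Adj u v) :
    adjEntry (localComplement (localComplement B u) v) u v = 1 := by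
  rw [adjEntry_comm, adjEntry_localComplement_left, adjEntry_comm, adjEntry_localComplement_left,
    adjEntry_eq_one.mpr huv]

theorem adjEntry_pivot_edge (huv : B.Adj u v) : adjEntry (pivot B u v) u v = 1 := by
  rw [pivot, adjEntry_localComplement_left, adjEntry_localComplement_localComplement_edge huv]

theorem adjEntry_pivot_left (huv : B.Adj u v) {j : Fin n} (hju : j ≠ u) (hjv : j ≠ v) :
    adjEntry (pivot B u v) u j = adjEntry B v j := by
  rw [pivot, adjEntry_localComplement_left,
    adjEntry_localComplement_localComplement_left huv hju hjv]

theorem adjEntry_pivot_right (huv : B.Adj u v) {j : Fin n} (hju : j ≠ u) (hjv : j ≠ v) :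
    adjEntry (pivot B u v) v j = adjEntry B u j := by
  have h : ∀ a b : ZMod 2, a + b + a = b := by decide
  rw [pivot, adjEntry_localComplement_of_ne _ _ hjv.symm,
    adjEntry_localComplement_localComplement_edge huv, one_mul,
    adjEntry_localComplement_localComplement_left huv hju hjv,
    adjEntry_localComplement_localComplement_right huv hjv, h]

theorem adjEntry_pivot_of_ne (huv : B.Adj u v) {i j : Fin n} (hij : i ≠ j) (hiu : i ≠ u)
    (hiv : i ≠ v) (hju : j ≠ u) (hjv : j ≠ v) :
    adjEntry (pivot B u v) i j =
      adjEntry B i j + adjEntry B u i * adjEntry B u j +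
        (adjEntry B v i + adjEntry B u i) * (adjEntry B v j + adjEntry B u j) +
          adjEntry B v i * adjEntry B v j := by
  rw [pivot, adjEntry_localComplement_of_ne _ _ hij,
    adjEntry_localComplement_localComplement_left huv hiu hiv,
    adjEntry_localComplement_localComplement_left huv hju hjv,
    adjEntry_localComplement_of_ne _ _ hij, adjEntry_localComplement_of_ne _ _ hij,
    adjEntry_localComplement_of_ne _ _ hiv.symm, adjEntry_localComplement_of_ne _ _ hjv.symm,
    adjEntry_eq_one.mpr huv, one_mul, one_mul]

theorem adjEntry_pivot_row_left (huv : B.Adj u v) (x : Fin n) :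
    adjEntry (pivot B u v) u x =
      adjEntry B v x + (if x = v then 1 else 0) + (if x = u then 1 else 0) := by
  by_cases hxu : x = u
  · subst hxu
    rw [adjEntry_self, if_neg huv.ne, if_pos rfl, adjEntry_eq_one.mpr huv.symm]; rfl
  · by_cases hxv : x = v
    · subst hxv
      rw [adjEntry_pivot_edge huv, adjEntry_self, if_neg hxu, if_pos rfl]; rfl
    · rw [adjEntry_pivot_left huv hxu hxv]; simp [hxu, hxv]

variable {X : Finset (Fin n)}

/-- This is a Gaussian elimination step: the check at v is added to every check y adjacent to u,
which eliminates u in favour of v. -/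
theorem IsSide.adjEntry_pivot_row (h : IsSide B X) (huv : B.Adj u v) (hu : u ∈ X) {y : Fin n}
    (hy : y ∉ X) (hyv : y ≠ v) (x : Fin n) :
    adjEntry (pivot B u v) y x =
      adjEntry B y x + adjEntry B u y * (adjEntry B v x + if x = v then 1 else 0) := by
  have hv : v ∉ X := (h u v huv).mp hu
  have hyu : y ≠ u := fun e => hy (e ▸ hu)
  have hvy : adjEntry B v y = 0 := h.adjEntry_eq_zero (by tauto)
  by_cases hxu : x = u
  · subst hxu
    have two : ∀ a : ZMod 2, 0 = a + a := by decide
    rw [adjEntry_comm, adjEntry_pivot_left huv hyu hyv, hvy, if_neg huv.ne,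
      adjEntry_eq_one.mpr huv.symm, add_zero, mul_one, adjEntry_comm B y x, ← two]
  by_cases hxv : x = v
  · subst hxv
    rw [adjEntry_comm, adjEntry_pivot_right huv hyu hyv, adjEntry_comm B y x, hvy, adjEntry_self,
      if_pos rfl]
    ring
  by_cases hxy : y = x
  · subst hxy
    rw [adjEntry_self, adjEntry_self, hvy, if_neg hxv]; ring
  rw [adjEntry_pivot_of_ne huv hxy hyu hyv hxu hxv, hvy, if_neg hxv]
  have key : ∀ e a c d : ZMod 2, e + a * c + (0 + a) * (d + c) + 0 * d = e + a * (d + 0) := by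
    decide
  exact key _ _ _ _

theorem IsSide.isSide_pivot (h : IsSide B X) (huv : B.Adj u v) (hu : u ∈ X) :
    IsSide (pivot B u v) (insert v (X.erase u)) := by
  have hv : v ∉ X := (h u v huv).mp hu
  have two : (1 + 1 : ZMod 2) = 0 := rfl
  have hnotY : ∀ a b, a ∉ insert v (X.erase u) → b ∉ insert v (X.erase u) →
      adjEntry (pivot B u v) a b = 0 := by
    intro a b ha hb
    simp only [Finset.mem_insert, Finset.mem_erase, not_or, not_and] at ha hb
    by_cases hau : a = u
    · subst hau
      rw [adjEntry_pivot_row_left huv]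
      by_cases hbu : b = a
      · subst hbu
        rw [adjEntry_eq_one.mpr huv.symm, if_neg huv.ne, if_pos rfl, add_zero, two]
      · rw [h.adjEntry_eq_zero (a := v) (b := b) (by have := hb.2 hbu; tauto)]
        simp [hb.1, hbu]
    · rw [h.adjEntry_pivot_row huv hu (ha.2 hau) ha.1, if_neg hb.1]
      by_cases hbu : b = u
      · subst hbu
        rw [adjEntry_comm B a b, adjEntry_eq_one.mpr huv.symm, add_zero, mul_one]
        generalize adjEntry B b a = z
        revert z
        decide
      · have := ha.2 hau
        have := hb.2 hbu
        rw [h.adjEntry_eq_zero (a := v) (b := b) (by tauto),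
          h.adjEntry_eq_zero (a := a) (b := b) (by tauto)]
        ring
  have hnotX : ∀ a b, a ∈ insert v (X.erase u) → b ∈ insert v (X.erase u) → a ≠ b → b ≠ v →
      adjEntry (pivot B u v) a b = 0 := by
    intro a b ha hb hab hbv
    simp only [Finset.mem_insert, Finset.mem_erase] at ha hb
    replace hb := hb.resolve_left hbv
    have hub : adjEntry B u b = 0 := h.adjEntry_eq_zero (by tauto)
    rcases ha with rfl | ha
    · rw [adjEntry_pivot_right huv hb.1 hbv, hub]
    · have hav : a ≠ v := fun e => hv (e ▸ ha.2)
      have hua : adjEntry B u a = 0 := h.adjEntry_eq_zero (by tauto)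
      rw [adjEntry_pivot_of_ne huv hab ha.1 hav hb.1 hbv, hua, hub,
        h.adjEntry_eq_zero (a := a) (b := b) (by tauto)]
      generalize adjEntry B v a = p
      generalize adjEntry B v b = q
      revert p q
      decide
  intro a b hab
  have hab1 := adjEntry_eq_one.mpr hab
  constructor
  · intro ha hb
    by_cases hbv : b = v
    · have h0 := hnotX b a hb ha hab.ne' (fun e => hab.ne (e.trans hbv.symm))
      rw [adjEntry_comm, hab1] at h0
      exact one_ne_zero h0
    · rw [hnotX a b ha hb hab.ne hbv] at hab1
      exact zero_ne_one hab1
  · intro hb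
    by_contra ha
    rw [hnotY a b ha hb] at hab1
    exact zero_ne_one hab1

/-- The check of the pivot at u is equivalent to the old check at v; modulo that check, the
remaining ones are unchanged. -/
theorem IsSide.bipartiteCode_pivot (h : IsSide B X) (huv : B.Adj u v) (hu : u ∈ X) :
    bipartiteCode (pivot B u v) (insert v (X.erase u)) = bipartiteCode B X := by
  have hv : v ∉ X := (h u v huv).mp hu
  ext c
  have hrowu : ∑ x, adjEntry (pivot B u v) u x * c x =
      (∑ x, adjEntry B v x * c x) + c v + c u := by
    simp [adjEntry_pivot_row_left huv, add_mul, Finset.sum_add_distrib]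
  have hrow : ∀ y, y ∉ X → y ≠ v → ∑ x, adjEntry (pivot B u v) y x * c x =
      (∑ x, adjEntry B y x * c x) + adjEntry B u y * ((∑ x, adjEntry B v x * c x) + c v) := by
    intro y hy hyv
    simp only [h.adjEntry_pivot_row huv hu hy hyv, add_mul, mul_add, Finset.sum_add_distrib,
      mul_assoc, ← Finset.mul_sum]
    simp
  have two : ∀ a : ZMod 2, a + a = 0 := by decide
  rw [mem_bipartiteCode, mem_bipartiteCode]
  have key : ∀ a b d : ZMod 2, a = b + d + a ↔ d = b := by decide
  have hmem : ∀ y, y ∉ insert v (X.erase u) ↔ y = u ∨ (y ∉ X ∧ y ≠ v) := by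
    intro y
    simp only [Finset.mem_insert, Finset.mem_erase]
    by_cases hyu : y = u
    · subst hyu; simp [huv.ne]
    · simp [hyu]; tauto
  constructor
  · intro hc
    have hcu := hc u ((hmem u).mpr (Or.inl rfl))
    rw [hrowu, key] at hcu
    intro y hy
    by_cases hyv : y = v
    · subst hyv; exact hcu
    · rw [hc y ((hmem y).mpr (Or.inr ⟨hy, hyv⟩)), hrow y hy hyv, ← hcu, two, mul_zero, add_zero]
  · intro hc y hy
    have hcv := hc v hv
    rcases (hmem y).mp hy with rfl | ⟨hyX, hyv⟩
    · rw [hrowu, key]; exact hcv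
    · rw [hrow y hyX hyv, ← hcv, two, mul_zero, add_zero]
      exact hc y hyX

end Pivot

/-! ### Upper bound and conclusion -/

theorem localComplement_mem_lcOrbit {n : ℕ} {G K : SimpleGraph (Fin n)} (hK : K ∈ lcOrbit G)
    (v : Fin n) : localComplement K v ∈ lcOrbit G :=
  Relation.ReflTransGen.head (Or.inl ⟨v, (localComplement_localComplement K v).symm⟩) hK

theorem pivot_mem_lcOrbit {n : ℕ} {G K : SimpleGraph (Fin n)} (hK : K ∈ lcOrbit G)
    (u v : Fin n) : pivot K u v ∈ lcOrbit G :=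
  localComplement_mem_lcOrbit (localComplement_mem_lcOrbit (localComplement_mem_lcOrbit hK _) _) _

/-- Some graph in the orbit presents the same code with an information set that spans `I`: every
vertex of `I` outside of it has all its neighbours in `I`. -/
theorem IsSide.exists_spanning {n : ℕ} {G B : SimpleGraph (Fin n)} {X : Finset (Fin n)}
    (h : IsSide B X) (hB : B ∈ lcOrbit G) (I : Finset (Fin n)) :
    ∃ B' ∈ lcOrbit G, ∃ X', IsSide B' X' ∧ bipartiteCode B' X' = bipartiteCode B X ∧
      X'.card = X.card ∧ ∀ y ∈ I, y ∉ X' → ∀ x, B'.Adj y x → x ∈ I := by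
  classical
  let P : Finset (Fin n) → Prop := fun X' => ∃ B' ∈ lcOrbit G, IsSide B' X' ∧
    bipartiteCode B' X' = bipartiteCode B X ∧ X'.card = X.card
  -- X' maximises |X' ∩ I|. An edge from y in I \ X' to x outside I would permit a pivot that
  -- exchanges x for y and increases this intersection.
  obtain ⟨X', hX', hmax⟩ := Finset.exists_max_image (Finset.univ.filter P)
    (fun X' => (X' ∩ I).card) ⟨X, by simpa [P] using ⟨B, hB, h, rfl⟩⟩
  obtain ⟨B', hB', hs, hc, hcard⟩ := (Finset.mem_filter.mp hX').2
  refine ⟨B', hB', X', hs, hc, hcard, fun y hyI hyX x hyx => ?_⟩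
  by_contra hxI
  have hxX : x ∈ X' := by
    by_contra hx
    exact hyX ((hs y x hyx).mpr hx)
  have hP : P (insert y (X'.erase x)) := by
    refine ⟨pivot B' x y, pivot_mem_lcOrbit hB' x y, hs.isSide_pivot hyx.symm hxX,
      (hs.bipartiteCode_pivot hyx.symm hxX).trans hc, ?_⟩
    rw [Finset.card_insert_of_notMem fun hy => hyX (Finset.mem_of_mem_erase hy),
      Finset.card_erase_add_one hxX, hcard]
  have hle := hmax _ (Finset.mem_filter.mpr ⟨Finset.mem_univ _, hP⟩)
  have heq : insert y (X'.erase x) ∩ I = insert y (X' ∩ I) := by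
    ext z
    simp only [Finset.mem_inter, Finset.mem_insert, Finset.mem_erase]
    constructor
    · rintro ⟨rfl | ⟨-, hz⟩, hzI⟩
      · exact Or.inl rfl
      · exact Or.inr ⟨hz, hzI⟩
    · rintro (rfl | ⟨hz, hzI⟩)
      · exact ⟨Or.inl rfl, hyI⟩
      · exact ⟨Or.inr ⟨fun e => hxI (e ▸ hzI), hz⟩, hzI⟩
  rw [heq, Finset.card_insert_of_notMem fun hy => hyX (Finset.mem_inter.mp hy).1] at hle
  omega

theorem exists_le_two_pow_indepNum {n : ℕ} {G B : SimpleGraph (Fin n)} (hB : B ∈ lcOrbit G)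
    (hbip : B.IsBipartite) :
    ∃ K ∈ lcOrbit G, ∀ r ∈ productSpectrum (graphState B), r ≤ 2 ^ K.indepNum := by
  classical
  obtain ⟨X, hX⟩ := exists_isSide hbip
  let d : Finset (Fin n) → ℕ := fun A =>
    Module.finrank (ZMod 2) (vanishing (bipartiteCode B X) A)
  obtain ⟨I, -, hI⟩ := Finset.exists_min_image Finset.univ
    (fun A : Finset (Fin n) => ((Finset.univ \ A).card : ℤ) - 2 * d A) ⟨∅, Finset.mem_univ _⟩
  -- The function −d is the rank function of the code's column matroid minus dim C, hence monotone
  -- and submodular. With t equal to the minimum attained at I, the result is d(S) + d(Sᶜ) ≤ 2 d(I)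
  -- − |Iᶜ|.
  obtain ⟨S, -, hS⟩ := exists_le_rank_add_rank_sdiff (r := fun A => -(d A : ℤ))
    (fun A C h => by
      have : d C ≤ d A := Submodule.finrank_mono (vanishing_anti _ h)
      simpa using this)
    (fun A C => by
      have : d A + d C ≤ d (A ∪ C) + d (A ∩ C) := finrank_vanishing_supermodular _ A C
      omega)
    (((Finset.univ \ I).card : ℤ) - 2 * d I) Finset.univ ∅ ∅
    (fun A _ => by
      have := hI A (Finset.mem_univ A)
      simp only [Finset.union_empty]
      linarith)
  simp only [Finset.union_empty, ← Finset.compl_eq_univ_sdiff] at hS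
  obtain ⟨K, hK, X', hX', hcode, hcard, hspan⟩ := hX.exists_spanning hB I
  refine ⟨K, hK, fun r hr => (hX.le_of_mem_productSpectrum S hr).trans ?_⟩
  refine pow_le_pow_right₀ one_le_two ?_
  -- Edges inside X' \ I or inside I \ X' violate bipartiteness; edges between the two sets violate
  -- the spanning property.
  have hindep : K.IsIndepSet ((X' \ I ∪ I \ X' : Finset (Fin n)) : Set (Fin n)) := by
    intro a ha b hb _ hab
    simp only [Finset.coe_union, Finset.coe_sdiff, Set.mem_union, Set.mem_sdiff,
      Finset.mem_coe] at ha hb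
    have hside := hX' a b hab
    rcases ha with ha | ha
    · rcases hb with hb | hb
      · exact hside.mp ha.1 hb.1
      · exact ha.2 (hspan b hb.1 hb.2 a hab.symm)
    · rcases hb with hb | hb
      · exact hb.2 (hspan a ha.1 ha.2 b hab)
      · exact ha.2 (hside.mpr hb.2)
  refine le_trans ?_ hindep.card_le_indepNum
  rw [Finset.card_union_of_disjoint
    (Finset.disjoint_left.mpr fun a ha hb => (Finset.mem_sdiff.mp ha).2 (Finset.mem_sdiff.mp hb).1)]
  have hdI : d I ≤ (X' \ I).card := by
    have := hX'.finrank_vanishing_le I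
    rwa [hcode] at this
  have c1 := Finset.card_compl_add_card X
  have c2 := Finset.card_compl_add_card I
  have c3 := Finset.card_sdiff_add_card_inter X' I
  have c4 := Finset.card_sdiff_add_card_inter I X'
  rw [Finset.inter_comm] at c4
  change Xᶜ.card + (d S + d Sᶜ) ≤ _
  -- The exponent is at most |I| − |X'| + 2 d(I), and d(I) ≤ |X' \ I| bounds this by |X' \ I| + |I \
  -- X'|.
  omega

theorem isGreatest_powerSpectrum_two_pow_lam {n : ℕ} {G K : SimpleGraph (Fin n)}
    (hbip : ∃ B ∈ lcOrbit G, B.IsBipartite) (hK : K ∈ lcOrbit G)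
    {f : (Fin n → ZMod 2) → ZMod 2} (hf : Corresponds f K) :
    IsGreatest (powerSpectrum transformU (signVector f)) ((2 : ℝ) ^ lam G) := by
  obtain ⟨B, hB, hbip⟩ := hbip
  obtain ⟨⟨M, hM, hlam⟩, hub⟩ := isGreatest_lam G
  rw [powerSpectrum_transformU, productSpectrum_eq_of_corresponds hf,
    productSpectrum_of_mem_lcOrbit hK]
  constructor
  · rw [← hlam, ← productSpectrum_of_mem_lcOrbit hM]
    exact two_pow_indepNum_mem_productSpectrum M
  · intro r hr
    obtain ⟨L, hL, hle⟩ := exists_le_two_pow_indepNum hB hbip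
    rw [← productSpectrum_of_mem_lcOrbit hB] at hr
    exact (hle r hr).trans (pow_le_pow_right₀ one_le_two (hub ⟨L, hL, rfl⟩))

end BipartiteLC

theorem mainTheorem7 (n : ℕ) (G : SimpleGraph (Fin n))
    (hbip : ∃ B ∈ BipartiteLC.lcOrbit G, B.IsBipartite)
    (K : SimpleGraph (Fin n)) (hK : K ∈ BipartiteLC.lcOrbit G)
    (f : (Fin n → ZMod 2) → ZMod 2) (hf : BipartiteLC.Corresponds f K) :
    IsGreatest (BipartiteLC.powerSpectrum BipartiteLC.transformU (BipartiteLC.signVector f))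
        (BipartiteLC.PAR BipartiteLC.transformU (BipartiteLC.signVector f)) ∧
      BipartiteLC.PAR BipartiteLC.transformU (BipartiteLC.signVector f)
        = (2 : ℝ) ^ BipartiteLC.lam G := by
  have hmax := BipartiteLC.isGreatest_powerSpectrum_two_pow_lam hbip hK hf
  have hPAR : BipartiteLC.PAR BipartiteLC.transformU (BipartiteLC.signVector f) =
      (2 : ℝ) ^ BipartiteLC.lam G := hmax.csSup_eq
  exact ⟨hPAR ▸ hmax, hPAR⟩
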